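/- Lemma 5.1. All rings are associative with identity. A finite ring $R$ with Jacobson radical $M$ has property (T) if $R$ is completely primary (that is, $R/M$ is a division ring, necessarily a finite field), $M^3=0$ and $M^2\neq 0$. Let $\operatorname{ann}(M)=\{x\in R : xM=Mx=0\}$. A ring $R$ with property (T) and of prime characteristic $p$ has invariants $p,n,r,s,t,\lambda$ if $|R|=p^{nr}$, $|R/M|=p^r$, and over the field $F=R/M$ the spaces $M/\operatorname{ann}(M)$, $M^2$ and $\operatorname{ann}(M)/M^2$ have dimensions $s$, $t$ and $\lambda$ respectively (so that $n=1+s+\lambda+t$). Let $p$ be a prime, $r\geq 1$ and $\lambda\geq 0$ integers, $s=t=1$ and $n=\lambda+3$. Then there are exactly $$ r\cdot\binom{r+\lambda-1}{\lambda} $$ isomorphism classes of rings with property (T) and characteristic $p$ having the invariants $p,n,r,s,t,\lambda$ (all of these rings have the same order $p^{nr}$). Exactly one of these classes consists of commutative rings; the rings in all the other classes are non-commutative. -/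

import Mathlib

universe u

/-- A ring (associative, with identity) is completely primary if its quotient by the Jacobson
radical is a division ring. -/
structure IsCompletelyPrimary (R : Type u) [Ring R] : Prop where
  nontrivial_quotient : Nontrivial (R ⧸ Ring.jacobson R)
  isUnit_of_ne_zero : ∀ x : R ⧸ Ring.jacobson R, x ≠ 0 → IsUnit x

/-- Property (T): a finite completely primary ring whose Jacobson radical `M`
(the set of all zero-divisors, `0` included) satisfies `M ^ 3 = 0` and `M ^ 2 ≠ 0`. -/
structure PropertyT (R : Type u) [Ring R] : Prop where
  finite : Finite R
  completelyPrimary : IsCompletelyPrimary R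
  cube_eq_bot : Ring.jacobson R ^ 3 = ⊥
  square_ne_bot : Ring.jacobson R ^ 2 ≠ ⊥

/-- The two-sided annihilator `ann(M)` of the Jacobson radical `M`. -/
def annRadical (R : Type u) [Ring R] : Set R :=
  {x | ∀ m ∈ Ring.jacobson R, x * m = 0 ∧ m * x = 0}

/-- `R` has characteristic `p` and invariants `p, n, r, s, t, lam`: the order of `R` is `p ^ (n r)`,
the residue field `F = R / M` has `p ^ r` elements, and the successive layers of
`M ⊇ ann(M) ⊇ M ^ 2 ⊇ 0` have dimensions `s`, `lam`, `t` over `F`.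
So in a decomposition `R = F ⊕ U ⊕ V ⊕ W` with `W = M ^ 2`, `V ⊕ W = ann(M)`,
`U ⊕ V ⊕ W = M`, the dimensions of `U`, `V`, `W` over `F` are `s`, `lam`, `t`. -/
structure HasInvariants (R : Type u) [Ring R] (p n r s t lam : ℕ) : Prop where
  charP : CharP R p
  card_ring : Nat.card R = p ^ (n * r)
  card_residue : Nat.card (R ⧸ Ring.jacobson R) = p ^ r
  card_square : Nat.card ↥(Ring.jacobson R ^ 2) = (p ^ r) ^ t
  card_ann : Nat.card ↥(annRadical R) = (p ^ r) ^ (lam + t)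
  card_radical : Nat.card ↥(Ring.jacobson R) = (p ^ r) ^ (s + lam + t)

/-- The rings with property (T), of characteristic `p` and with the given invariants. -/
def TRing (p n r s t lam : ℕ) : Type (u + 1) :=
  {R : RingCat.{u} // PropertyT R ∧ HasInvariants R p n r s t lam}

/-- Isomorphism of rings. -/
def tRingSetoid (p n r s t lam : ℕ) : Setoid (TRing.{u} p n r s t lam) where
  r R S := Nonempty (R.1 ≃+* S.1)
  iseqv :=
    { refl := fun _ => ⟨RingEquiv.refl _⟩
      symm := fun ⟨e⟩ => ⟨e.symm⟩
      trans := fun ⟨e⟩ ⟨f⟩ => ⟨e.trans f⟩ }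

/-- The isomorphism classes of the rings with property (T), of characteristic `p` and with the
given invariants. -/
def TRingClass (p n r s t lam : ℕ) : Type (u + 1) :=
  Quotient (tRingSetoid.{u} p n r s t lam)

/-- The class consists of commutative rings. -/
def TRingClass.IsCommutative {p n r s t lam : ℕ} (c : TRingClass.{u} p n r s t lam) : Prop :=
  ∀ R : TRing.{u} p n r s t lam, Quotient.mk (tRingSetoid.{u} p n r s t lam) R = c →
    ∀ x y : R.1, x * y = y * x

/-! Such a ring is determined by Frobenius twists. Let `K` be the field with `p ^ r` elements. A
copy of `K` lifts into `R`, making `R` a `K`-bimodule. The order of `Kˣ` is prime to `p`, so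
averaging over `Kˣ` shows that every sub-bimodule is spanned by weight vectors, those `x` with `x *
a = σ a * x` for an endomorphism `σ` of `K`. As `s = 1`, `M = K u + ann(M)` for a weight vector `u`;
hence `M ^ 2 = K u ^ 2`, and `u ^ 2` has weight `σ ∘ σ`. Completing `u ^ 2` to a basis of `ann(M)`
by weight vectors `v_j` of weights `τ_j` fixes the whole multiplication table, so `R` is a twisted
ring (`PropertyT.exists_ringEquiv`).

Conversely, `σ` is visible in the action on `M / ann(M)`, and the sizes of the eigenspaces in
`ann(M)` count how often each twist occurs among the `τ_j`, once the known contribution of `u ^ 2`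
is removed (`TwistedRing.exponents_eq_of_ringEquiv`). The endomorphisms of `K` are the `r` powers of
Frobenius, so the classes correspond to pairs of an exponent and a multiset of `lam` exponents.
Commutativity means that all twists are trivial. -/

/-- The vector space `K ⊕ K U ⊕ K W ⊕ ⨁ j, K V_j`, to be multiplied by the rules `W = U ^ 2`,
`U * a = σ a * U` and `V_j * a = τ_j a * V_j`, all other products of `U`, `W`, `V_j` being `0`. -/
@[ext]
structure TwistedRing {K : Type u} [Field K] {ι : Type} (σ : K →+* K) (τ : ι → K →+* K) :
    Type u where
  a : K
  b : K
  c : K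
  v : ι → K

/-! ### Twisted rings: radical, annihilator and invariants -/

namespace TwistedRing

variable {K : Type u} [Field K] {ι : Type} {σ : K →+* K} {τ : ι → K →+* K}

instance : Zero (TwistedRing σ τ) := ⟨⟨0, 0, 0, 0⟩⟩
instance : One (TwistedRing σ τ) := ⟨⟨1, 0, 0, 0⟩⟩
instance : Add (TwistedRing σ τ) := ⟨fun x y => ⟨x.a + y.a, x.b + y.b, x.c + y.c, x.v + y.v⟩⟩
instance : Neg (TwistedRing σ τ) := ⟨fun x => ⟨-x.a, -x.b, -x.c, -x.v⟩⟩
instance : Mul (TwistedRing σ τ) :=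
  ⟨fun x y => ⟨x.a * y.a, x.a * y.b + x.b * σ y.a,
    x.a * y.c + x.b * σ y.b + x.c * σ (σ y.a), fun j => x.a * y.v j + x.v j * τ j y.a⟩⟩

@[simp] lemma zero_a : (0 : TwistedRing σ τ).a = 0 := rfl
@[simp] lemma zero_b : (0 : TwistedRing σ τ).b = 0 := rfl
@[simp] lemma zero_c : (0 : TwistedRing σ τ).c = 0 := rfl
@[simp] lemma zero_v (j : ι) : (0 : TwistedRing σ τ).v j = 0 := rfl
@[simp] lemma one_a : (1 : TwistedRing σ τ).a = 1 := rfl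
@[simp] lemma one_b : (1 : TwistedRing σ τ).b = 0 := rfl
@[simp] lemma one_c : (1 : TwistedRing σ τ).c = 0 := rfl
@[simp] lemma one_v (j : ι) : (1 : TwistedRing σ τ).v j = 0 := rfl

section

variable (x y : TwistedRing σ τ)

@[simp] lemma add_a : (x + y).a = x.a + y.a := rfl
@[simp] lemma add_b : (x + y).b = x.b + y.b := rfl
@[simp] lemma add_c : (x + y).c = x.c + y.c := rfl
@[simp] lemma add_v (j : ι) : (x + y).v j = x.v j + y.v j := rfl
@[simp] lemma neg_a : (-x).a = -x.a := rfl
@[simp] lemma neg_b : (-x).b = -x.b := rfl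
@[simp] lemma neg_c : (-x).c = -x.c := rfl
@[simp] lemma neg_v (j : ι) : (-x).v j = -x.v j := rfl
@[simp] lemma mul_a : (x * y).a = x.a * y.a := rfl
@[simp] lemma mul_b : (x * y).b = x.a * y.b + x.b * σ y.a := rfl
@[simp] lemma mul_c : (x * y).c = x.a * y.c + x.b * σ y.b + x.c * σ (σ y.a) := rfl
@[simp] lemma mul_v (j : ι) : (x * y).v j = x.a * y.v j + x.v j * τ j y.a := rfl

end

lemma ext' {x y : TwistedRing σ τ} (ha : x.a = y.a) (hb : x.b = y.b) (hc : x.c = y.c)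
    (hv : ∀ j, x.v j = y.v j) : x = y :=
  TwistedRing.ext ha hb hc (funext hv)

instance : Ring (TwistedRing σ τ) where
  add_assoc x y z := by apply ext' <;> intros <;> simp <;> ring
  zero_add x := by apply ext' <;> intros <;> simp
  add_zero x := by apply ext' <;> intros <;> simp
  add_comm x y := by apply ext' <;> intros <;> simp <;> ring
  nsmul := nsmulRec
  zsmul := zsmulRec
  left_distrib x y z := by apply ext' <;> intros <;> simp <;> ring
  right_distrib x y z := by apply ext' <;> intros <;> simp <;> ring
  zero_mul x := by apply ext' <;> intros <;> simp
  mul_zero x := by apply ext' <;> intros <;> simp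
  mul_assoc x y z := by apply ext' <;> intros <;> simp <;> ring
  one_mul x := by apply ext' <;> intros <;> simp
  mul_one x := by apply ext' <;> intros <;> simp
  neg_add_cancel x := by apply ext' <;> intros <;> simp

/-- The coordinates of an element. -/
def equivProd : TwistedRing σ τ ≃ K × K × K × (ι → K) where
  toFun x := ⟨x.a, x.b, x.c, x.v⟩
  invFun y := ⟨y.1, y.2.1, y.2.2.1, y.2.2.2⟩
  left_inv _ := rfl
  right_inv _ := rfl

instance [Finite K] [Finite ι] : Finite (TwistedRing σ τ) := Finite.of_equiv _ equivProd.symm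

/-- The reduction modulo the radical. -/
def residue : TwistedRing σ τ →+* K where
  toFun := a
  map_one' := rfl
  map_mul' _ _ := rfl
  map_zero' := rfl
  map_add' _ _ := rfl

/-- The inclusion of the coefficient field. -/
def coeff : K →+* TwistedRing σ τ where
  toFun a := ⟨a, 0, 0, 0⟩
  map_one' := rfl
  map_mul' _ _ := by apply ext' <;> simp
  map_zero' := rfl
  map_add' _ _ := by apply ext' <;> simp

/-- Reindexing the generators `V_j`. -/
def reindex {ι' : Type} (e : ι' ≃ ι) : TwistedRing σ τ ≃+* TwistedRing σ (τ ∘ e) where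
  toFun x := ⟨x.a, x.b, x.c, x.v ∘ e⟩
  invFun x := ⟨x.a, x.b, x.c, x.v ∘ e.symm⟩
  left_inv x := by apply ext' <;> simp
  right_inv x := by apply ext' <;> simp
  map_mul' x y := by apply ext' <;> simp
  map_add' x y := by apply ext' <;> simp

lemma mul_mul_eq_zero {x y z : TwistedRing σ τ} (hx : x.a = 0) (hy : y.a = 0) (hz : z.a = 0) :
    x * y * z = 0 := by
  apply ext' <;> simp [hx, hy, hz]

lemma mul_eq_of_a_eq_zero {x y : TwistedRing σ τ} (hx : x.a = 0) (hy : y.a = 0) :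
    x * y = ⟨0, 0, x.b * σ y.b, 0⟩ := by
  apply ext' <;> simp [hx, hy]

lemma isNilpotent_iff {x : TwistedRing σ τ} : IsNilpotent x ↔ x.a = 0 := by
  refine ⟨fun h => ?_, fun h => ⟨3, by rw [pow_succ, sq, mul_mul_eq_zero h h h]⟩⟩
  exact (h.map residue).eq_zero

lemma mem_jacobson {x : TwistedRing σ τ} : x ∈ Ring.jacobson (TwistedRing σ τ) ↔ x.a = 0 := by
  rw [← Ideal.jacobson_bot, Ideal.mem_jacobson_iff]
  constructor
  · intro h
    by_contra hx
    -- With this multiplier `1 + y * x` has residue `0`, so it has no left inverse.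
    obtain ⟨z, hz⟩ := h (coeff (-x.a⁻¹))
    have := congr_arg residue ((Submodule.mem_bot _).1 hz)
    have h1 : (coeff x.a⁻¹ : TwistedRing σ τ).a = x.a⁻¹ := rfl
    have h2 : z.a * (-x.a⁻¹) * x.a + z.a - 1 = 0 := by
      simpa [residue, sub_eq_add_neg, h1] using this
    field_simp at h2
    simp at h2
  · intro hx y
    -- The geometric series for `(1 + y * x)⁻¹` stops here because `(y * x) ^ 3 = 0`.
    refine ⟨1 - y * x + y * x * (y * x), (Submodule.mem_bot _).2 ?_⟩
    have h : (y * x) * (y * x) * (y * x) = 0 :=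
      mul_mul_eq_zero (by simp [hx]) (by simp [hx]) (by simp [hx])
    have h' : (1 - y * x + y * x * (y * x)) * y * x + (1 - y * x + y * x * (y * x)) - 1
      = (y * x) * (y * x) * (y * x) := by noncomm_ring
    rw [h', h]

lemma mem_jacobson_sq {x : TwistedRing σ τ} :
    x ∈ Ring.jacobson (TwistedRing σ τ) ^ 2 ↔ ∃ c, x = ⟨0, 0, c, 0⟩ := by
  rw [Submodule.pow_succ, Submodule.pow_one]
  constructor
  · intro hx
    let N : Ideal (TwistedRing σ τ) :=
      { carrier := {x | ∃ c, x = ⟨0, 0, c, 0⟩}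
        zero_mem' := ⟨0, rfl⟩
        add_mem' := by
          rintro _ _ ⟨c, rfl⟩ ⟨d, rfl⟩
          exact ⟨c + d, by apply ext' <;> simp⟩
        smul_mem' := by
          rintro y _ ⟨c, rfl⟩
          exact ⟨y.a * c, by apply ext' <;> simp⟩ }
    refine (Ideal.mul_le (K := N)).2 (fun y hy z hz => ?_) hx
    exact ⟨_, mul_eq_of_a_eq_zero (mem_jacobson.1 hy) (mem_jacobson.1 hz)⟩
  · rintro ⟨c, rfl⟩
    have := Ideal.mul_mem_mul (I := Ring.jacobson (TwistedRing σ τ))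
      (J := Ring.jacobson (TwistedRing σ τ)) (r := ⟨0, c, 0, 0⟩) (s := ⟨0, 1, 0, 0⟩)
      (mem_jacobson.2 rfl) (mem_jacobson.2 rfl)
    rw [mul_eq_of_a_eq_zero rfl rfl] at this
    simpa using this

/-- Testing against the single element `U` suffices: `x * U` has the coordinates `a` and `b` of `x`,
shifted by one place. -/
lemma mem_annRadical {x : TwistedRing σ τ} :
    x ∈ annRadical (TwistedRing σ τ) ↔ x.a = 0 ∧ x.b = 0 := by
  constructor
  · intro h
    obtain ⟨h, -⟩ := h ⟨0, 1, 0, 0⟩ (mem_jacobson.2 rfl)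
    exact ⟨by simpa using congr_arg b h, by simpa using congr_arg c h⟩
  · rintro ⟨ha, hb⟩ m hm
    have hm := mem_jacobson.1 hm
    constructor <;> apply ext' <;> simp [ha, hb, hm]

lemma card_jacobson_sq : Nat.card ↥(Ring.jacobson (TwistedRing σ τ) ^ 2) = Nat.card K := by
  refine Nat.card_congr
    { toFun x := x.1.c
      invFun y := ⟨⟨0, 0, y, 0⟩, mem_jacobson_sq.2 ⟨y, rfl⟩⟩
      left_inv x := ?_
      right_inv _ := rfl }
  obtain ⟨c, hc⟩ := mem_jacobson_sq.1 x.2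
  exact Subtype.ext (by simp [hc])

lemma card_residue : Nat.card (TwistedRing σ τ ⧸ Ring.jacobson (TwistedRing σ τ)) = Nat.card K := by
  have h : RingHom.ker (residue : TwistedRing σ τ →+* K) = Ring.jacobson (TwistedRing σ τ) := by
    ext x
    exact mem_jacobson.symm
  rw [← h]
  exact Nat.card_congr
    (RingHom.quotientKerEquivOfSurjective (f := (residue : TwistedRing σ τ →+* K))
      fun a => ⟨coeff a, rfl⟩).toEquiv

section card

variable [Fintype ι]

lemma card_eq : Nat.card (TwistedRing σ τ) = Nat.card K ^ (3 + Fintype.card ι) := by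
  rw [Nat.card_congr equivProd, Nat.card_prod, Nat.card_prod, Nat.card_prod, Nat.card_fun,
    Nat.card_eq_fintype_card (α := ι)]
  ring

lemma card_jacobson :
    Nat.card (Ring.jacobson (TwistedRing σ τ)) = Nat.card K ^ (2 + Fintype.card ι) := by
  have e : Ring.jacobson (TwistedRing σ τ) ≃ K × K × (ι → K) :=
    { toFun x := ⟨x.1.b, x.1.c, x.1.v⟩
      invFun y := ⟨⟨0, y.1, y.2.1, y.2.2⟩, mem_jacobson.2 rfl⟩
      left_inv x := Subtype.ext (ext' (mem_jacobson.1 x.2).symm rfl rfl fun _ => rfl)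
      right_inv _ := rfl }
  rw [Nat.card_congr e, Nat.card_prod, Nat.card_prod, Nat.card_fun,
    Nat.card_eq_fintype_card (α := ι)]
  ring

lemma card_annRadical :
    Nat.card (annRadical (TwistedRing σ τ)) = Nat.card K ^ (1 + Fintype.card ι) := by
  have e : annRadical (TwistedRing σ τ) ≃ K × (ι → K) :=
    { toFun x := ⟨x.1.c, x.1.v⟩
      invFun y := ⟨⟨0, 0, y.1, y.2⟩, mem_annRadical.2 ⟨rfl, rfl⟩⟩
      left_inv x := Subtype.ext (ext' (mem_annRadical.1 x.2).1.symm (mem_annRadical.1 x.2).2.symm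
        rfl fun _ => rfl)
      right_inv _ := rfl }
  rw [Nat.card_congr e, Nat.card_prod, Nat.card_fun, Nat.card_eq_fintype_card (α := ι)]
  ring

end card

lemma propertyT [Finite K] [Finite ι] : PropertyT (TwistedRing σ τ) where
  finite := inferInstance
  completelyPrimary :=
    { nontrivial_quotient := by
        rw [Ideal.Quotient.nontrivial_iff, Ne, Ideal.eq_top_iff_one, mem_jacobson]
        simp
      isUnit_of_ne_zero := by
        intro x hx
        obtain ⟨x, rfl⟩ := Ideal.Quotient.mk_surjective x
        rw [Ne, Ideal.Quotient.eq_zero_iff_mem, mem_jacobson] at hx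
        refine isUnit_iff_exists.2 ⟨Ideal.Quotient.mk _ (coeff x.a⁻¹), ?_, ?_⟩ <;>
        · rw [← map_mul, ← map_one (Ideal.Quotient.mk _), Ideal.Quotient.eq, mem_jacobson]
          simp [sub_eq_add_neg, coeff, hx] }
  cube_eq_bot := by
    rw [Submodule.pow_succ, eq_bot_iff, Ideal.mul_le]
    intro x hx y hy
    obtain ⟨c, rfl⟩ := mem_jacobson_sq.1 hx
    have := mem_jacobson.1 hy
    rw [Submodule.mem_bot]
    apply ext' <;> simp [this]
  square_ne_bot h := by
    have : (⟨0, 0, 1, 0⟩ : TwistedRing σ τ) ∈ Ring.jacobson (TwistedRing σ τ) ^ 2 :=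
      mem_jacobson_sq.2 ⟨1, rfl⟩
    rw [h, Submodule.mem_bot] at this
    simpa using congr_arg c this

lemma hasInvariants [Finite K] [Fintype ι] {p r : ℕ} [CharP K p] (hK : Nat.card K = p ^ r) :
    HasInvariants (TwistedRing σ τ) p (1 + 1 + Fintype.card ι + 1) r 1 1 (Fintype.card ι) where
  charP := charP_of_injective_ringHom (f := (coeff : K →+* TwistedRing σ τ))
    (fun _ _ h => congr_arg a h) p
  card_ring := by rw [card_eq, hK]; ring
  card_residue := by rw [card_residue, hK]
  card_square := by rw [card_jacobson_sq, hK, pow_one]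
  card_ann := by rw [card_annRadical, hK]; ring
  card_radical := by rw [card_jacobson, hK]; ring

end TwistedRing

/-! ### Endomorphisms of a finite field -/

/-- An endomorphism fixes the prime field, hence is one of the `r` powers of Frobenius over `ZMod
p`. Twists may thus be encoded by exponents. -/
lemma iterateFrobenius_bijective {K : Type u} [Field K] [Finite K] {p r : ℕ} [Fact p.Prime]
    [CharP K p] (hK : Nat.card K = p ^ r) :
    Function.Bijective fun i : Fin r => iterateFrobenius K p i := by
  let _ := ZMod.algebra K p
  have hr : Module.finrank (ZMod p) K = r := by
    have h := Module.natCard_eq_pow_finrank (K := ZMod p) (V := K)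
    rw [hK, Nat.card_zmod] at h
    exact (Nat.pow_right_injective (Fact.out : p.Prime).two_le h).symm
  subst hr
  have key : ∀ (i : ℕ) (x : K),
      (FiniteField.frobeniusAlgHom (ZMod p) K ^ i) x = iterateFrobenius K p i x := by
    intro i x
    rw [AlgHom.coe_pow, FiniteField.coe_frobeniusAlgHom, pow_iterate, ZMod.card,
      iterateFrobenius_def]
  obtain ⟨h1, h2⟩ := FiniteField.bijective_frobeniusAlgHom_pow (ZMod p) K
  constructor
  · intro i j hij
    apply h1
    ext x
    simpa [key] using RingHom.congr_fun hij x
  · intro f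
    have hf : ∀ a, f (algebraMap (ZMod p) K a) = algebraMap (ZMod p) K a := fun a =>
      RingHom.congr_fun (RingHom.ext_zmod (f.comp (algebraMap (ZMod p) K)) _) a
    obtain ⟨i, hi⟩ := h2 { f with commutes' := hf }
    refine ⟨i, RingHom.ext fun x => ?_⟩
    rw [← key]
    exact DFunLike.congr_fun hi x

/-! ### Recovering the twists from the ring -/

/-- Modulo the annihilator of the nilpotent elements, nilpotent elements commute with all elements
up to raising the latter to the `k`-th power. -/
def CommutesUpToPow (R : Type*) [Ring R] (k : ℕ) : Prop :=
  ∀ x a m : R, IsNilpotent x → IsNilpotent m → (x * a - a ^ k * x) * m = 0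

/-- The elements annihilated by the nilpotent elements that commute with all elements up to raising
the latter to the `k`-th power. -/
def powEigenspace (R : Type*) [Ring R] (k : ℕ) : Set R :=
  {x | (∀ m, IsNilpotent m → x * m = 0 ∧ m * x = 0) ∧ ∀ a, x * a = a ^ k * x}

section transport

variable {R S : Type*} [Ring R] [Ring S]

lemma CommutesUpToPow.of_ringEquiv (e : R ≃+* S) {k : ℕ} (h : CommutesUpToPow S k) :
    CommutesUpToPow R k := by
  intro x a m hx hm
  apply e.injective
  simpa using h (e x) (e a) (e m) (hx.map e) (hm.map e)

lemma mem_powEigenspace_of_ringEquiv (e : R ≃+* S) {k : ℕ} {x : R} (h : x ∈ powEigenspace R k) :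
    e x ∈ powEigenspace S k := by
  refine ⟨fun m hm => ?_, fun a => ?_⟩
  · obtain ⟨h1, h2⟩ := h.1 (e.symm m) (hm.map e.symm)
    exact ⟨by simpa using congr_arg e h1, by simpa using congr_arg e h2⟩
  · simpa using congr_arg e (h.2 (e.symm a))

lemma card_powEigenspace_of_ringEquiv (e : R ≃+* S) (k : ℕ) :
    Nat.card (powEigenspace R k) = Nat.card (powEigenspace S k) :=
  Nat.card_congr (e.toEquiv.subtypeEquiv fun x =>
    ⟨mem_powEigenspace_of_ringEquiv e, fun h => by
      simpa using mem_powEigenspace_of_ringEquiv e.symm h⟩)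

end transport

namespace TwistedRing

variable {K : Type u} [Field K] {ι : Type} {σ : K →+* K} {τ : ι → K →+* K}

lemma pow_a (x : TwistedRing σ τ) (k : ℕ) : (x ^ k).a = x.a ^ k := map_pow residue x k

/-- Multiplying by a nilpotent `m` leaves only the `U`-coordinate visible. The left side mentions no
coefficient field, so any isomorphism preserves it. -/
lemma commutesUpToPow_iff {k : ℕ} :
    CommutesUpToPow (TwistedRing σ τ) k ↔ ∀ a, σ a = a ^ k := by
  constructor
  · intro h a
    have := congr_arg c (h ⟨0, 1, 0, 0⟩ (coeff a) ⟨0, 1, 0, 0⟩ (isNilpotent_iff.2 rfl)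
      (isNilpotent_iff.2 rfl))
    rw [← map_pow] at this
    simpa [sub_eq_add_neg, coeff, add_neg_eq_zero] using this
  · intro h x a m hx hm
    rw [isNilpotent_iff] at hx hm
    have hb : (x * a - a ^ k * x).b = 0 := by
      have : x.b * σ a.a = a.a ^ k * x.b := by rw [h, mul_comm]
      simp [sub_eq_add_neg, hx, pow_a, this]
    have ha : (x * a - a ^ k * x).a = 0 := by simp [sub_eq_add_neg, hx]
    apply ext' <;> simp [ha, hb, hm]

lemma mem_powEigenspace {k : ℕ} {x : TwistedRing σ τ} :
    x ∈ powEigenspace (TwistedRing σ τ) k ↔ x.a = 0 ∧ x.b = 0 ∧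
      (x.c = 0 ∨ ∀ a, σ (σ a) = a ^ k) ∧ ∀ j, x.v j = 0 ∨ ∀ a, τ j a = a ^ k := by
  constructor
  · rintro ⟨h1, h2⟩
    obtain ⟨h, -⟩ := h1 ⟨0, 1, 0, 0⟩ (isNilpotent_iff.2 rfl)
    have ha : x.a = 0 := by simpa using congr_arg b h
    have hb : x.b = 0 := by simpa using congr_arg c h
    refine ⟨ha, hb, ?_, fun j => ?_⟩
    · by_cases hc : x.c = 0
      · exact .inl hc
      · refine .inr fun a => mul_left_cancel₀ hc ?_
        have := congr_arg c (h2 (coeff a))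
        rw [← map_pow] at this
        simpa [coeff, ha, hb, mul_comm (a ^ k)] using this
    · by_cases hv : x.v j = 0
      · exact .inl hv
      · refine .inr fun a => mul_left_cancel₀ hv ?_
        have := congr_fun (congr_arg v (h2 (coeff a))) j
        rw [← map_pow] at this
        simpa [coeff, ha, hb, mul_comm (a ^ k)] using this
  · rintro ⟨ha, hb, hc, hv⟩
    refine ⟨fun m hm => ?_, fun y => ?_⟩
    · rw [isNilpotent_iff] at hm
      constructor <;> apply ext' <;> simp [ha, hb, hm]
    · apply ext'
      · simp [ha]
      · simp [ha, hb]
      · rcases hc with hc | hc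
        · simp [ha, hb, hc]
        · have : x.c * σ (σ y.a) = y.a ^ k * x.c := by rw [hc, mul_comm]
          simp [ha, hb, pow_a, this]
      · intro j
        rcases hv j with hv | hv
        · simp [ha, hv]
        · have : x.v j * τ j y.a = y.a ^ k * x.v j := by rw [hv, mul_comm]
          simp [ha, pow_a, this]

open Classical in
lemma card_eq_zero_or (q : Prop) :
    Nat.card {x : K // x = 0 ∨ q} = if q then Nat.card K else 1 := by
  by_cases h : q
  · simp [h]
  · simp [h]

open Classical in
lemma card_powEigenspace [Fintype ι] (k : ℕ) :
    Nat.card (powEigenspace (TwistedRing σ τ) k) =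
      (if ∀ a, σ (σ a) = a ^ k then Nat.card K else 1) *
        ∏ j, if ∀ a, τ j a = a ^ k then Nat.card K else 1 := by
  have e : powEigenspace (TwistedRing σ τ) k ≃ {x : K // x = 0 ∨ ∀ a, σ (σ a) = a ^ k} ×
      ∀ j, {x : K // x = 0 ∨ ∀ a, τ j a = a ^ k} :=
    { toFun x := ⟨⟨x.1.c, (mem_powEigenspace.1 x.2).2.2.1⟩,
        fun j => ⟨x.1.v j, (mem_powEigenspace.1 x.2).2.2.2 j⟩⟩
      invFun y := ⟨⟨0, 0, y.1, fun j => y.2 j⟩,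
        mem_powEigenspace.2 ⟨rfl, rfl, y.1.2, fun j => (y.2 j).2⟩⟩
      left_inv x := Subtype.ext (ext' (mem_powEigenspace.1 x.2).1.symm
        (mem_powEigenspace.1 x.2).2.1.symm rfl fun _ => rfl)
      right_inv _ := rfl }
  rw [Nat.card_congr e, Nat.card_prod, Nat.card_pi, card_eq_zero_or]
  simp_rw [card_eq_zero_or]

variable (K) in
/-- The twisted ring whose twists are powers of the Frobenius automorphism. -/
abbrev OfExponents (p : ℕ) [Fact p.Prime] [CharP K p] {r : ℕ} (i : Fin r)
    (f : ι → Fin r) : Type u :=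
  TwistedRing (iterateFrobenius K p i) fun j => iterateFrobenius K p (f j)

section exponents

variable [Finite K] {p r : ℕ} [Fact p.Prime] [CharP K p]

lemma iterateFrobenius_eq_pow_iff (hK : Nat.card K = p ^ r) {i j : Fin r} :
    (∀ a, iterateFrobenius K p i a = a ^ p ^ (j : ℕ)) ↔ i = j := by
  constructor
  · exact fun h => (iterateFrobenius_bijective hK).1 (RingHom.ext fun a => by
      simpa [iterateFrobenius_def] using h a)
  · rintro rfl a
    exact iterateFrobenius_def p _ a

/-- Once `i = i'` is known, the line `K W`, of weight `σ ∘ σ`, contributes the same factor to both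
eigenspaces and cancels. What remains is `Nat.card K` to the multiplicity of the exponent `m`. -/
lemma exponents_eq_of_ringEquiv (hK : Nat.card K = p ^ r) [Fintype ι] {i i' : Fin r}
    {f f' : ι → Fin r} (e : OfExponents K p i f ≃+* OfExponents K p i' f') :
    i = i' ∧ Finset.univ.val.map f = Finset.univ.val.map f' := by
  classical
  have hi : i = i' := by
    rw [← iterateFrobenius_eq_pow_iff hK, ← 
      commutesUpToPow_iff (τ := fun j => iterateFrobenius K p (f j))]
    exact (commutesUpToPow_iff.2 ((iterateFrobenius_eq_pow_iff hK).2 rfl)).of_ringEquiv e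
  subst hi
  refine ⟨rfl, Multiset.ext.2 fun m => ?_⟩
  have h := card_powEigenspace_of_ringEquiv e (p ^ (m : ℕ))
  rw [card_powEigenspace, card_powEigenspace] at h
  have h0 : 0 < Nat.card K := Nat.card_pos
  have h1 := Nat.eq_of_mul_eq_mul_left (by split_ifs <;> omega) h
  simp_rw [iterateFrobenius_eq_pow_iff hK, Finset.prod_ite, Finset.prod_const_one, mul_one,
    Finset.prod_const] at h1
  have h2 := Nat.pow_right_injective (Finite.one_lt_card (α := K)) h1
  simpa [Multiset.count_map, Finset.card, eq_comm] using h2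

end exponents

end TwistedRing

/-- The multiplicities are the sizes of the fibres; bijections between corresponding fibres are
glued. -/
lemma exists_equiv_of_map_univ_eq {α β : Type*} [Fintype α] {f g : α → β}
    (h : (Finset.univ : Finset α).val.map f = Finset.univ.val.map g) :
    ∃ e : α ≃ α, g ∘ e = f := by
  classical
  have H : ∀ b, Nonempty ({a // f a = b} ≃ {a // g a = b}) := by
    intro b
    refine ⟨Fintype.equivOfCardEq ?_⟩
    have := congr_arg (Multiset.count b) h
    rw [Fintype.card_subtype, Fintype.card_subtype]
    simpa [Multiset.count_map, Finset.card, eq_comm] using this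
  let e b := (H b).some
  refine ⟨(Equiv.sigmaFiberEquiv f).symm.trans
    ((Equiv.sigmaCongrRight e).trans (Equiv.sigmaFiberEquiv g)), funext fun a => ?_⟩
  exact (e (f a) ⟨a, rfl⟩).2

/-! ### Lifting the residue field -/

section coefficient

/-- Wedderburn's theorem makes `D` a field, and finite fields of equal order are isomorphic. -/
lemma nonempty_ringEquiv_of_isUnit {K D : Type*} [Field K] [Finite K] [Ring D] [Nontrivial D]
    [Finite D] (hD : ∀ x : D, x ≠ 0 → IsUnit x) (hcard : Nat.card K = Nat.card D) :
    Nonempty (K ≃+* D) := by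
  let _ : DivisionRing D := DivisionRing.ofIsUnitOrEqZero fun a => (em (a = 0)).symm.imp (hD a) id
  have e : ∀ (F : Field D), Nonempty (K ≃+* D) := by
    intro F
    have := Fintype.ofFinite K
    have := Fintype.ofFinite D
    exact ⟨FiniteField.ringEquivOfCardEq (by simpa using hcard)⟩
  exact e (littleWedderburn D)

open Polynomial in
/-- A completely primary ring of characteristic `p` whose radical has cube zero contains a copy of
its residue field. -/
theorem exists_coefficient_hom {K : Type u} [Field K] [Finite K] {p : ℕ} [Fact p.Prime]
    [CharP K p] {R : Type u} [Ring R] [CharP R p] (h : PropertyT R)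
    (hcard : Nat.card K = Nat.card (R ⧸ Ring.jacobson R)) : Nonempty (K →+* R) := by
  have := h.finite
  have := h.completelyPrimary.nontrivial_quotient
  have : Finite (R ⧸ Ring.jacobson R) := Quotient.finite _
  obtain ⟨e⟩ := nonempty_ringEquiv_of_isUnit h.completelyPrimary.isUnit_of_ne_zero hcard
  let _ := ZMod.algebra R p
  let _ := ZMod.algebra K p
  let pb := Field.powerBasisOfFiniteOfSeparable (ZMod p) K
  obtain ⟨g, hg⟩ := Ideal.Quotient.mk_surjective (I := Ring.jacobson R) (e pb.gen)
  set f := minpoly (ZMod p) pb.gen with hf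
  have hmem : aeval g f ∈ Ring.jacobson R := by
    rw [← Ideal.Quotient.eq_zero_iff_mem, aeval_def, hom_eval₂, hg]
    have : e (aeval pb.gen f) = 0 := by rw [hf, minpoly.aeval, map_zero]
    rw [aeval_def, ← RingEquiv.coe_toRingHom, hom_eval₂] at this
    convert this using 2
    · exact Subsingleton.elim _ _
    · rfl
  have hcube : aeval g f ^ 3 = 0 := by
    have := Ideal.pow_mem_pow hmem 3
    rwa [h.cube_eq_bot, Submodule.mem_bot] at this
  -- Since `f` has coefficients in `ZMod p`, `f (g ^ p ^ 2) = f g ^ p ^ 2`, which vanishes as `p ^ 2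
  -- ≥ 3`. A single `p`-th power would not be enough when `p = 2`.
  have hpow : f ^ p ^ 2 = expand (ZMod p) (p ^ 2) f := by
    rw [sq p, pow_mul, ← ZMod.expand_card, ← ZMod.expand_card, expand_expand]
  have hroot : aeval (g ^ p ^ 2) f = 0 := by
    rw [← expand_aeval, ← hpow, map_pow]
    refine pow_eq_zero_of_le ?_ hcube
    nlinarith [(Fact.out : p.Prime).two_le]
  exact ⟨(pb.lift (g ^ p ^ 2) hroot).toRingHom⟩

end coefficient

/-! ### Weight decomposition of bimodules over a finite field -/

section eigenvectors

variable {K : Type u} [Field K] {R : Type u} [Ring R]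

/-- `x` is a weight vector of weight `σ` for the two-sided action of `K` on `R`. -/
def IsWeight (φ : K →+* R) (σ : K →+* K) (x : R) : Prop :=
  ∀ a, x * φ a = φ (σ a) * x

lemma sum_pow_succ_units [Fintype K] [DecidableEq K] (a : Kˣ) :
    ∑ k ∈ Finset.range (Fintype.card K - 1), (a : K) ^ (k + 1) = if a = 1 then -1 else 0 := by
  split_ifs with h
  · have h1 : 1 ≤ Fintype.card K := Fintype.card_pos
    simp [h, Nat.cast_sub h1, Nat.cast_card_eq_zero]
  · have h1 : (a : K) - 1 ≠ 0 := fun h' => h (Units.ext (sub_eq_zero.1 h'))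
    simp_rw [pow_succ, ← Finset.sum_mul]
    have h2 := geom_sum_mul (a : K) (Fintype.card K - 1)
    rw [FiniteField.pow_card_sub_one_eq_one _ a.ne_zero, sub_self] at h2
    rw [(mul_eq_zero.1 h2).resolve_right h1, zero_mul]

lemma eq_zero_of_map_mul_eq_zero (φ : K →+* R) {a : K} {y : R} (h : φ a * y = 0) (ha : a ≠ 0) :
    y = 0 := by
  rw [← one_mul y, ← map_one φ, ← inv_mul_cancel₀ ha, map_mul, mul_assoc, h, mul_zero]

/-- If `y ≠ 0`, additivity of `b ↦ y * φ b` forces `b ↦ b ^ k` to be additive. The zero vector has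
every weight. -/
lemma exists_isWeight_of_pow (φ : K →+* R) {k : ℕ} (hk : k ≠ 0) {y : R}
    (hy : ∀ b, y * φ b = φ (b ^ k) * y) : ∃ σ : K →+* K, IsWeight φ σ y := by
  by_cases h0 : y = 0
  · exact ⟨RingHom.id K, fun a => by simp [h0]⟩
  · refine ⟨{ toFun b := b ^ k, map_one' := one_pow k, map_zero' := zero_pow hk,
              map_mul' := fun a b => mul_pow a b k, map_add' := fun a b => ?_ }, hy⟩
    have h1 : φ ((a + b) ^ k - (a ^ k + b ^ k)) * y = 0 := by
      rw [map_sub, sub_mul, ← hy, map_add φ, map_add φ, mul_add, add_mul, hy, hy, sub_self]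
    by_contra h2
    exact h0 (eq_zero_of_map_mul_eq_zero φ h1 (sub_ne_zero.2 h2))

/-- A sub-bimodule over a finite field is spanned by its weight vectors. -/
theorem le_closure_weights [Finite K] (φ : K →+* R) (N : AddSubgroup R)
    (hl : ∀ a, ∀ x ∈ N, φ a * x ∈ N) (hr : ∀ a, ∀ x ∈ N, x * φ a ∈ N) :
    N ≤ AddSubgroup.closure {y | y ∈ N ∧ ∃ σ, IsWeight φ σ y} := by
  classical
  have := Fintype.ofFinite K
  intro x hx
  -- Up to sign, `y k` is the component of `x` on which right multiplication by `b` is left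
  -- multiplication by `b ^ k`; replacing `a` by `b * a` in the sum shows this.
  let y (k : ℕ) : R := ∑ a : Kˣ, φ ((a : K) ^ k) * x * φ (a⁻¹ : Kˣ)
  have hy : ∀ k, k ≠ 0 → ∀ b, y k * φ b = φ (b ^ k) * y k := by
    intro k hk b
    by_cases hb : b = 0
    · simp [hb, hk]
    · lift b to Kˣ using IsUnit.mk0 b hb
      simp only [y, Finset.sum_mul, Finset.mul_sum]
      refine (Fintype.sum_equiv (Equiv.mulLeft b) _ _ fun a => ?_).symm
      have h1 : φ (a⁻¹ : Kˣ) = φ ((b * a)⁻¹ : Kˣ) * φ b := by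
        rw [← map_mul, ← Units.val_mul]
        simp
      rw [h1, Equiv.coe_mulLeft, Units.val_mul, mul_pow, map_mul]
      simp only [mul_assoc]
  -- By orthogonality only `a = 1` survives. The exponents run from `1`, not `0`, so that the weight
  -- relation also holds at `b = 0`.
  have hsum : ∑ k ∈ Finset.range (Fintype.card K - 1), y (k + 1) = -x := by
    simp only [y]
    rw [Finset.sum_comm]
    simp_rw [← Finset.sum_mul, ← map_sum, sum_pow_succ_units]
    rw [Finset.sum_eq_single 1]
    · simp
    · intro a _ ha
      simp [ha]
    · simp
  rw [← neg_mem_iff, ← hsum]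
  refine sum_mem fun k _ => AddSubgroup.subset_closure ⟨sum_mem fun a _ => hr _ _ (hl _ _ hx), ?_⟩
  exact exists_isWeight_of_pow φ k.succ_ne_zero (hy _ k.succ_ne_zero)

end eigenvectors

/-! ### Homomorphisms out of a twisted ring -/

namespace TwistedRing

variable {K : Type u} [Field K] {ι : Type} [Fintype ι] {σ : K →+* K} {τ : ι → K →+* K}
  {R : Type u} [Ring R]

/-- The homomorphism out of a twisted ring given by the images of the coefficient field and of the
generators. -/
def lift (φ : K →+* R) (u : R) (v : ι → R) (hu : IsWeight φ σ u) (hv : ∀ j, IsWeight φ (τ j) (v j))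
    (huuu : u * u * u = 0) (huv : ∀ j, u * v j = 0) (hvu : ∀ j, v j * u = 0)
    (hvv : ∀ i j, v i * v j = 0) : TwistedRing σ τ →+* R where
  toFun x := φ x.a + φ x.b * u + φ x.c * (u * u) + ∑ j, φ (x.v j) * v j
  map_one' := by simp
  map_zero' := by simp
  map_add' x y := by
    simp only [add_a, add_b, add_c, add_v, map_add, add_mul, Finset.sum_add_distrib]
    abel
  map_mul' x y := by
    have h1 : ∀ z, (∑ j, φ (x.v j) * v j) * φ z = ∑ j, φ (x.v j * τ j z) * v j := by
      intro z
      rw [Finset.sum_mul]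
      refine Finset.sum_congr rfl fun j _ => ?_
      rw [mul_assoc, hv j, map_mul, mul_assoc]
    have h2 : (∑ j, φ (x.v j) * v j) * u = 0 := by
      simp [Finset.sum_mul, mul_assoc, hvu]
    have h3 : ∀ w : ι → K, u * ∑ j, φ (w j) * v j = 0 := by
      intro w
      rw [Finset.mul_sum]
      refine Finset.sum_eq_zero fun j _ => ?_
      rw [← mul_assoc, hu, mul_assoc, huv, mul_zero]
    have h4 : (∑ j, φ (x.v j) * v j) * ∑ j, φ (y.v j) * v j = 0 := by
      rw [Finset.mul_sum]
      refine Finset.sum_eq_zero fun j _ => ?_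
      rw [← mul_assoc, h1, Finset.sum_mul]
      exact Finset.sum_eq_zero fun i _ => by rw [mul_assoc, hvv, mul_zero]
    have h5 : φ x.a * ∑ j, φ (y.v j) * v j = ∑ j, φ (x.a * y.v j) * v j := by
      simp [Finset.mul_sum, mul_assoc]
    have h6 : ∀ z w, u * (φ z * w) = φ (σ z) * (u * w) := by
      intro z w
      rw [← mul_assoc, hu, mul_assoc]
    have h7 : ∀ z w, (∑ j, φ (x.v j) * v j) * (φ z * (u * w)) = 0 := by
      intro z w
      rw [← mul_assoc, h1, ← mul_assoc, Finset.sum_mul]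
      simp [mul_assoc, hvu]
    have h8 : ∀ z, (∑ j, φ (x.v j) * v j) * (φ z * u) = 0 := fun z => by
      simpa using h7 z 1
    have h9 : u * (u * u) = 0 := by rw [← mul_assoc, huuu]
    have h10 := hu (y.a)
    simp only [mul_a, mul_b, mul_c, mul_v, map_add, add_mul, mul_add, Finset.sum_add_distrib,
      mul_assoc, h1, h3, h4, h5, h6, h7, h8, h9, h10, map_mul, mul_zero, add_zero]
    abel

end TwistedRing

/-! ### The structure theorem -/

namespace PropertyT

variable {R : Type u} [Ring R]

lemma mul_mul_eq_zero (h : PropertyT R) {x y z : R} (hx : x ∈ Ring.jacobson R)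
    (hy : y ∈ Ring.jacobson R) (hz : z ∈ Ring.jacobson R) : x * y * z = 0 := by
  have : x * y * z ∈ Ring.jacobson R ^ 3 := by
    rw [Submodule.pow_succ, Submodule.pow_succ, Submodule.pow_one]
    exact Ideal.mul_mem_mul (Ideal.mul_mem_mul hx hy) hz
  rwa [h.cube_eq_bot, Submodule.mem_bot] at this

lemma exists_mul_ne_zero (h : PropertyT R) :
    ∃ x ∈ Ring.jacobson R, ∃ y ∈ Ring.jacobson R, x * y ≠ 0 := by
  by_contra! H
  apply h.square_ne_bot
  rw [Submodule.pow_succ, Submodule.pow_one, eq_bot_iff, Ideal.mul_le]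
  exact fun x hx y hy => (Submodule.mem_bot _).2 (H x hx y hy)

/-- If `x` is outside `M`, then `y * x - 1 ∈ M` for some `y`, so `M ^ 3 = 0` gives `(y * x - 1) * m
* m' = 0`. As `x * m = 0`, this forces `m * m' = 0`, contrary to `M ^ 2 ≠ 0`. -/
lemma annRadical_subset (h : PropertyT R) {x : R} (hx : x ∈ annRadical R) :
    x ∈ Ring.jacobson R := by
  by_contra hxJ
  rw [← Ideal.Quotient.eq_zero_iff_mem] at hxJ
  obtain ⟨y, -, hy⟩ := isUnit_iff_exists.1 (h.completelyPrimary.isUnit_of_ne_zero _ hxJ)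
  obtain ⟨y, rfl⟩ := Ideal.Quotient.mk_surjective y
  rw [← map_mul, ← map_one (Ideal.Quotient.mk _), Ideal.Quotient.eq] at hy
  obtain ⟨m, hm, m', hm', hmm⟩ := h.exists_mul_ne_zero
  have h1 := h.mul_mul_eq_zero hy hm hm'
  rw [sub_mul, mul_assoc y, (hx m hm).1, mul_zero, one_mul, zero_sub, neg_mul, neg_eq_zero] at h1
  exact hmm h1

/-- `ann(M)` as an additive subgroup. -/
def annSubgroup (R : Type u) [Ring R] : AddSubgroup R where
  carrier := annRadical R
  zero_mem' m _ := by simp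
  add_mem' ha hb m hm := by simp [add_mul, mul_add, ha m hm, hb m hm]
  neg_mem' ha m hm := by simp [ha m hm]

lemma mem_annSubgroup {x : R} : x ∈ annSubgroup R ↔ x ∈ annRadical R := Iff.rfl

lemma mul_mem_annRadical {x : R} (hx : x ∈ annRadical R) (a : R) :
    a * x ∈ annRadical R ∧ x * a ∈ annRadical R := by
  constructor
  · intro m hm
    rw [mul_assoc, (hx m hm).1, ← mul_assoc,
      (hx _ (Ideal.mul_mem_right a (Ring.jacobson R) hm)).2, mul_zero]
    exact ⟨rfl, rfl⟩
  · intro m hm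
    rw [mul_assoc, (hx _ (Ideal.mul_mem_left _ a hm)).1, ← mul_assoc, (hx m hm).2, zero_mul]
    exact ⟨rfl, rfl⟩

/-- The radical contains a weight vector outside the annihilator. -/
lemma exists_weight (h : PropertyT R) {K : Type u} [Field K] [Finite K] (φ : K →+* R) :
    ∃ u ∈ Ring.jacobson R, u ∉ annRadical R ∧ ∃ σ, IsWeight φ σ u := by
  by_contra! H
  obtain ⟨x, hx, y, hy, hxy⟩ := h.exists_mul_ne_zero
  refine hxy (((AddSubgroup.closure_le (annSubgroup R)).2 ?_ (le_closure_weights φ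
    (Ring.jacobson R).toAddSubgroup (fun a z hz => Ideal.mul_mem_left _ _ hz)
    (fun a z hz => Ideal.mul_mem_right _ (Ring.jacobson R) hz) hx)) y hy).1
  rintro z ⟨hz, σ, hσ⟩
  by_contra hz'
  exact H z hz hz' σ hσ

section structureTheorem

variable {K : Type u} [Field K] {lam : ℕ}

/-- The map `(c, y) ↦ φ c * u + y` from `K × ann(M)` to `M` is injective because `u ∉ ann(M)`, and
both sides have the same size. -/
lemma exists_eq_add_annRadical (h : PropertyT R) (φ : K →+* R)
    (hann : Nat.card (annRadical R) = Nat.card K ^ (lam + 1))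
    (hrad : Nat.card (Ring.jacobson R) = Nat.card K ^ (lam + 2)) {u : R}
    (hu : u ∈ Ring.jacobson R) (hu' : u ∉ annRadical R) {x : R} (hx : x ∈ Ring.jacobson R) :
    ∃ c, ∃ y ∈ annRadical R, x = φ c * u + y := by
  have := h.finite
  let g (z : K × annSubgroup R) : Ring.jacobson R :=
    ⟨φ z.1 * u + z.2, add_mem (Ideal.mul_mem_left _ _ hu) (h.annRadical_subset z.2.2)⟩
  have hg : Function.Injective g := by
    intro z w hzw
    have h1 : φ z.1 * u + z.2 = φ w.1 * u + w.2 := congr_arg Subtype.val hzw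
    have h2 : φ (z.1 - w.1) * u ∈ annSubgroup R := by
      have : φ (z.1 - w.1) * u = w.2 - z.2 := by
        rw [map_sub, sub_mul, sub_eq_sub_iff_add_eq_add, h1, add_comm]
      rw [this]
      exact sub_mem w.2.2 z.2.2
    have h3 : z.1 = w.1 := by
      by_contra hne
      refine hu' ?_
      have := (mul_mem_annRadical (mem_annSubgroup.1 h2) (φ (z.1 - w.1)⁻¹)).1
      rwa [← mul_assoc, ← map_mul, inv_mul_cancel₀ (sub_ne_zero.2 hne), map_one, one_mul] at this
    refine Prod.ext h3 (Subtype.ext ?_)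
    rwa [h3, add_right_inj] at h1
  have hcard : Nat.card (Ring.jacobson R) ≤ Nat.card (K × annSubgroup R) := by
    rw [Nat.card_prod, hrad]
    change _ ≤ Nat.card K * Nat.card (annRadical R)
    rw [hann]
    exact le_of_eq (by ring)
  obtain ⟨z, hz⟩ := (hg.bijective_of_nat_card_le hcard).2 ⟨x, hx⟩
  exact ⟨z.1, z.2, z.2.2, (congr_arg Subtype.val hz).symm⟩

lemma exists_sub_mem_jacobson (h : PropertyT R) (φ : K →+* R)
    (hres : Nat.card (R ⧸ Ring.jacobson R) = Nat.card K) (x : R) :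
    ∃ a, x - φ a ∈ Ring.jacobson R := by
  have := h.finite
  have := h.completelyPrimary.nontrivial_quotient
  have : Finite (R ⧸ Ring.jacobson R) := Quotient.finite _
  obtain ⟨a, ha⟩ := ((((Ideal.Quotient.mk (Ring.jacobson R)).comp φ).injective
    ).bijective_of_nat_card_le hres.le).2 (Ideal.Quotient.mk _ x)
  exact ⟨a, Ideal.Quotient.eq.1 ha.symm⟩

/-- `ann(M)` has a basis over the coefficient field which consists of weight vectors and contains a
given weight vector. -/
lemma exists_weight_basis [Finite K] (h : PropertyT R) (φ : K →+* R)
    (hann : Nat.card (annRadical R) = Nat.card K ^ (lam + 1)) {w : R} (hw : w ∈ annRadical R)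
    (hw0 : w ≠ 0) (hw' : ∃ σ, IsWeight φ σ w) :
    ∃ v : Fin lam → R, (∀ j, v j ∈ annRadical R) ∧ (∀ j, ∃ σ, IsWeight φ σ (v j)) ∧
      ∀ x ∈ annRadical R, ∃ (c : K) (d : Fin lam → K), x = φ c * w + ∑ j, φ (d j) * v j := by
  classical
  have := h.finite
  let _ : Module K R := Module.compHom R φ
  have hsmul : ∀ (a : K) (x : R), a • x = φ a * x := fun _ _ => rfl
  let A : Submodule K R :=
    { annSubgroup R with smul_mem' := fun a x hx => (mul_mem_annRadical hx (φ a)).1 }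
  let E : Set R := {y | y ∈ annSubgroup R ∧ ∃ σ, IsWeight φ σ y}
  -- The weight vectors in `ann(M)` span it, so `{w}` extends to a basis chosen among them; counting
  -- elements gives its size `lam + 1`.
  obtain ⟨b, hbE, hwb, hEb, hb⟩ := exists_linearIndepOn_id_extension (K := K) (s := {w}) (t := E)
    ((linearIndepOn_singleton_iff K).2 hw0) (Set.singleton_subset_iff.2 ⟨hw, hw'⟩)
  rw [Set.singleton_subset_iff] at hwb
  have hspan : Submodule.span K b = A := by
    refine le_antisymm (Submodule.span_le.2 fun x hx => (hbE hx).1) fun x hx => ?_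
    have := le_closure_weights φ (annSubgroup R) (fun a z hz => (mul_mem_annRadical hz _).1)
      (fun a z hz => (mul_mem_annRadical hz _).2) hx
    exact (AddSubgroup.closure_le (Submodule.span K b).toAddSubgroup).2 hEb this
  have hcard : b.ncard = lam + 1 := by
    have h1 := Module.natCard_eq_pow_finrank (K := K) (V := Submodule.span K b)
    have := Fintype.ofFinite b
    rw [finrank_span_set_eq_card hb, hspan, ← Set.ncard_eq_toFinset_card'] at h1
    have h2 : Nat.card A = Nat.card (annRadical R) := rfl
    rw [h2, hann] at h1
    exact (Nat.pow_right_injective (Finite.one_lt_card (α := K)) h1).symm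
  have hcard' : Nat.card ↥(b \ {w}) = lam := by
    rw [Nat.card_coe_set_eq, Set.ncard_sdiff_singleton_of_mem hwb, hcard, Nat.add_sub_cancel]
  let g := (Finite.equivFinOfCardEq hcard').symm
  refine ⟨fun j => g j, fun j => (hbE (g j).2.1).1, fun j => (hbE (g j).2.1).2, fun x hx => ?_⟩
  have hrange : Set.range (fun j => (g j : R)) = b \ {w} := by
    rw [← Function.comp_def, Set.range_comp, g.surjective.range_eq, Set.image_univ,
      Subtype.range_coe]
  have hx : x ∈ Submodule.span K b := hspan ▸ hx
  rw [← Set.insert_eq_of_mem hwb, ← Set.insert_sdiff_singleton, ← hrange,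
    Submodule.mem_span_insert] at hx
  obtain ⟨c, z, hz, rfl⟩ := hx
  obtain ⟨d, rfl⟩ := (Submodule.mem_span_range_iff_exists_fun K).1 hz
  exact ⟨c, d, rfl⟩

/-- The structure theorem: rings with property (T), characteristic `p` and `s = t = 1` are twisted
rings. -/
theorem exists_ringEquiv [Finite K] (h : PropertyT R) {p n r : ℕ} [Fact p.Prime] [CharP K p]
    (hK : Nat.card K = p ^ r) (hn : n = 1 + 1 + lam + 1) (hR : HasInvariants R p n r 1 1 lam) :
    ∃ (i : Fin r) (f : Fin lam → Fin r), Nonempty (TwistedRing.OfExponents K p i f ≃+* R) := by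
  have := h.finite
  have := hR.charP
  have hres := hR.card_residue
  have hann := hR.card_ann
  have hrad := hR.card_radical
  have hring := hR.card_ring
  rw [mul_comm, pow_mul] at hring
  rw [← hK] at hres hann hrad hring
  obtain ⟨φ⟩ := exists_coefficient_hom (K := K) h hres.symm
  obtain ⟨u, hu, hu', σ, hσ⟩ := h.exists_weight φ
  have hrad' : Nat.card (Ring.jacobson R) = Nat.card K ^ (lam + 2) := by
    rw [hrad]; ring
  have hdec := fun {x : R} => h.exists_eq_add_annRadical φ hann hrad' hu hu' (x := x)
  have huu : u * u ∈ annRadical R := fun m hm =>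
    ⟨h.mul_mul_eq_zero hu hu hm, by rw [← mul_assoc, h.mul_mul_eq_zero hm hu hu]⟩
  -- Since `M = K u + ann(M)`, every product of two elements of `M` is a multiple of `u * u`.
  have huu0 : u * u ≠ 0 := by
    obtain ⟨x, hx, y, hy, hxy⟩ := h.exists_mul_ne_zero
    intro h0
    obtain ⟨c, x', hx', rfl⟩ := hdec hx
    obtain ⟨d, y', hy', rfl⟩ := hdec hy
    refine hxy ?_
    rw [add_mul, (hx' _ hy).1, mul_add, mul_assoc (φ c) u y', (hy' u hu).2, mul_assoc,
      ← mul_assoc u, hσ, mul_assoc, h0]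
    simp
  have hσσ : IsWeight φ (σ.comp σ) (u * u) := by
    intro a
    rw [mul_assoc, hσ, ← mul_assoc, hσ, mul_assoc]
    rfl
  obtain ⟨v, hv, hv', hspan⟩ := h.exists_weight_basis φ hann huu huu0 ⟨_, hσσ⟩
  choose τ hτ using hv'
  obtain ⟨i, rfl⟩ := (iterateFrobenius_bijective (K := K) (p := p) hK).2 σ
  choose f hf using fun j => (iterateFrobenius_bijective (K := K) (p := p) hK).2 (τ j)
  refine ⟨i, f, ?_⟩
  let Φ : TwistedRing.OfExponents K p i f →+* R :=
    TwistedRing.lift φ u v hσ (fun j => by simpa [← hf] using hτ j) (huu u hu).1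
      (fun j => (hv j u hu).2) (fun j => (hv j u hu).1)
      (fun j k => (hv j _ (h.annRadical_subset (hv k))).1)
  have hsurj : Function.Surjective Φ := by
    intro x
    obtain ⟨a, ha⟩ := h.exists_sub_mem_jacobson φ hres x
    obtain ⟨b, y, hy, hxy⟩ := hdec ha
    obtain ⟨c, d, rfl⟩ := hspan y hy
    refine ⟨⟨a, b, c, d⟩, ?_⟩
    rw [← sub_add_cancel x (φ a), hxy]
    change φ a + φ b * u + φ c * (u * u) + _ = _
    abel
  refine ⟨RingEquiv.ofBijective Φ (hsurj.bijective_of_nat_card_le ?_)⟩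
  rw [TwistedRing.card_eq, hring, hn, Fintype.card_fin]
  exact le_of_eq (by ring)

end structureTheorem

end PropertyT

/-! ### Counting the isomorphism classes -/

namespace TRing

section

variable {p n r lam : ℕ}

/-- The isomorphism class of a ring with property (T). -/
def toClass (R : TRing.{u} p n r 1 1 lam) : TRingClass.{u} p n r 1 1 lam :=
  Quotient.mk (tRingSetoid.{u} p n r 1 1 lam) R

lemma toClass_eq_iff {R S : TRing.{u} p n r 1 1 lam} :
    toClass R = toClass S ↔ Nonempty (R.1 ≃+* S.1) :=
  Quotient.eq

end

variable {K : Type u} [Field K] [Finite K] {p n r lam : ℕ} [Fact p.Prime] [CharP K p]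

/-- The twisted ring with exponents `i` and `f` as a ring with property (T). -/
def ofExponents (hK : Nat.card K = p ^ r) (hn : n = 1 + 1 + lam + 1) (i : Fin r)
    (f : Fin lam → Fin r) : TRing.{u} p n r 1 1 lam :=
  ⟨RingCat.of (TwistedRing.OfExponents K p i f), TwistedRing.propertyT, by
    have := TwistedRing.hasInvariants (σ := iterateFrobenius K p i)
      (τ := fun j => iterateFrobenius K p (f j)) hK
    rw [Fintype.card_fin] at this
    rwa [hn]⟩

lemma toClass_ofExponents_eq_iff (hK : Nat.card K = p ^ r) (hn : n = 1 + 1 + lam + 1)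
    {i i' : Fin r} {f f' : Fin lam → Fin r} :
    toClass (ofExponents hK hn i f) = toClass (ofExponents hK hn i' f') ↔
      i = i' ∧ Finset.univ.val.map f = Finset.univ.val.map f' := by
  rw [toClass_eq_iff]
  constructor
  · rintro ⟨e⟩
    exact TwistedRing.exponents_eq_of_ringEquiv hK e
  · rintro ⟨rfl, h⟩
    obtain ⟨e, rfl⟩ := exists_equiv_of_map_univ_eq h
    exact ⟨(TwistedRing.reindex (τ := fun j => iterateFrobenius K p (f' j)) e).symm⟩

lemma exists_toClass_ofExponents_eq (hK : Nat.card K = p ^ r) (hn : n = 1 + 1 + lam + 1)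
    (c : TRingClass.{u} p n r 1 1 lam) : ∃ i f, toClass (ofExponents hK hn i f) = c := by
  induction c using Quotient.inductionOn with | _ R =>
  obtain ⟨i, f, ⟨e⟩⟩ := R.2.1.exists_ringEquiv hK hn R.2.2
  exact ⟨i, f, toClass_eq_iff.2 ⟨e⟩⟩

/-- The classes are in bijection with `Fin r × Sym (Fin r) lam`, and stars and bars counts the
second factor. -/
lemma card_tRingClass (hK : Nat.card K = p ^ r) (hn : n = 1 + 1 + lam + 1) :
    Nat.card (TRingClass.{u} p n r 1 1 lam) = r * Nat.choose (r + lam - 1) lam := by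
  have hf : ∀ s : Sym (Fin r) lam, ∃ f : Fin lam → Fin r,
      Finset.univ.val.map f = (s : Multiset _) := by
    rintro ⟨s, hs⟩
    induction s using Quotient.inductionOn with | _ l =>
    obtain rfl : l.length = lam := hs
    exact ⟨l.get, by simp [Fin.univ_val_map]⟩
  choose f hf using hf
  let Ψ (z : Fin r × Sym (Fin r) lam) := toClass (ofExponents hK hn z.1 (f z.2))
  have hΨ : Function.Bijective Ψ := by
    constructor
    · intro z w hzw
      obtain ⟨h1, h2⟩ := (toClass_ofExponents_eq_iff hK hn).1 hzw
      rw [hf, hf] at h2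
      exact Prod.ext h1 (Sym.coe_injective h2)
    · intro c
      obtain ⟨i, g, rfl⟩ := exists_toClass_ofExponents_eq hK hn c
      refine ⟨⟨i, Finset.univ.val.map g, by simp⟩, (toClass_ofExponents_eq_iff hK hn).2 ⟨rfl, ?_⟩⟩
      rw [hf]
      rfl
  rw [← Nat.card_eq_of_bijective Ψ hΨ, Nat.card_prod, Nat.card_fin, Nat.card_eq_fintype_card,
    Sym.card_sym_eq_choose, Fintype.card_fin]

lemma isCommutative_ofExponents_iff (hK : Nat.card K = p ^ r) (hn : n = 1 + 1 + lam + 1)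
    (hr : 0 < r) {i : Fin r} {f : Fin lam → Fin r} :
    (toClass (ofExponents hK hn i f)).IsCommutative ↔ i = ⟨0, hr⟩ ∧ f = fun _ => ⟨0, hr⟩ := by
  constructor
  · intro h
    have h : ∀ x y : TwistedRing.OfExponents K p i f, x * y = y * x := h _ rfl
    have h0 : ∀ j : Fin r, (∀ a, iterateFrobenius K p j a = a) → j = ⟨0, hr⟩ := fun j hj =>
      (TwistedRing.iterateFrobenius_eq_pow_iff hK).1 (by simpa using hj)
    -- Commuting `U`, respectively `∑ j, V_j`, past a coefficient `a` shows that each twist fixes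
    -- `a`.
    refine ⟨h0 i fun a => ?_, funext fun j => h0 (f j) fun a => ?_⟩
    · simpa [TwistedRing.coeff] using
        congr_arg TwistedRing.b (h ⟨0, 1, 0, 0⟩ (TwistedRing.coeff a))
    · simpa [TwistedRing.coeff] using
        congr_fun (congr_arg TwistedRing.v (h ⟨0, 0, 0, fun _ => 1⟩ (TwistedRing.coeff a))) j
  · rintro ⟨rfl, rfl⟩ R hR x y
    obtain ⟨e⟩ := toClass_eq_iff.1 hR
    apply e.injective
    rw [map_mul, map_mul]
    have hcomm : ∀ x y : TwistedRing.OfExponents K p (⟨0, hr⟩ : Fin r)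
        fun _ : Fin lam => ⟨0, hr⟩, x * y = y * x := by
      intro x y
      apply TwistedRing.ext' <;> intros <;> simp <;> ring
    exact hcomm _ _

end TRing

theorem lemma5p1 (p n r lam : ℕ) (hp : p.Prime) (hr : 1 ≤ r) (hn : n = 1 + 1 + lam + 1) :
    Nat.card (TRingClass.{u} p n r 1 1 lam) = r * Nat.choose (r + lam - 1) lam ∧
      ∃! c : TRingClass.{u} p n r 1 1 lam, c.IsCommutative := by
  have : Fact p.Prime := ⟨hp⟩
  -- The coefficient field is lifted to the universe of the rings being classified.
  let K : Type u := ULift.{u} (GaloisField p r)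
  have hK : Nat.card K = p ^ r := by
    rw [Nat.card_congr Equiv.ulift, GaloisField.card p r (by omega)]
  have : Finite K := inferInstance
  have : CharP K p := charP_of_injective_ringHom
    (f := (ULift.ringEquiv (R := GaloisField p r)).symm.toRingHom)
    (ULift.ringEquiv (R := GaloisField p r)).symm.injective p
  refine ⟨TRing.card_tRingClass hK hn,
    TRing.toClass (TRing.ofExponents hK hn ⟨0, hr⟩ fun _ => ⟨0, hr⟩),
    (TRing.isCommutative_ofExponents_iff hK hn hr).2 ⟨rfl, rfl⟩, fun c hc => ?_⟩
  obtain ⟨i, f, rfl⟩ := TRing.exists_toClass_ofExponents_eq hK hn c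
  obtain ⟨rfl, rfl⟩ := (TRing.isCommutative_ofExponents_iff hK hn hr).1 hc
  rfl
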